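/- Call a probability distribution $\mu$ on $\mathbb{R}$ \emph{proper} if for $X\sim\mu$ one has $\mathbb{E}[X]=0$, $\mathbb{E}[X^2]=1$ and $\mathbb{E}[X^3]=0$, and \emph{hypercontractive} if there is a constant $c$ such that for all $m$, all $u\in\mathbb{R}^m$ and all real $q\ge 2$, $$\left(\mathbb{E}_{X\sim\mu^m}|\langle u,X\rangle|^q\right)^{1/q}\le c\sqrt{q}\,\left(\mathbb{E}_{X\sim\mu^m}|\langle u,X\rangle|^2\right)^{1/2}.$$ A matrix $W\in\mathbb{R}^{n\times k}$ is \emph{$\epsilon$-regular} if every column $u$ of $W$ satisfies $\sum_{i=1}^n u_i^4\le\epsilon^2\|u\|_2^2$. For a smooth function $\psi:\mathbb{R}^k\to\mathbb{R}$ put $$\|\psi^{(4)}\|_1=\sup_{a\in\mathbb{R}^k}\ \sum_{p,q,r,s=1}^k|\partial_p\partial_q\partial_r\partial_s\psi(a)|.$$ Theorem. Let $\mu$ be a proper and hypercontractive distribution on $\mathbb{R}$ and let $\epsilon_0<1$. There is a constant $C>0$, depending only on $\mu$ and $\epsilon_0$, such that the following holds. Let $n\ge 1$, $k\ge 2$,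 $0<\epsilon\le\epsilon_0$, let $W\in\mathbb{R}^{n\times k}$ be $\epsilon$-regular with columns of Euclidean norm one, and let $\psi:\mathbb{R}^k\to\mathbb{R}$ be a smooth ($C^\infty$) function with $\|\psi^{(4)}\|_1<\infty$. Then $\psi(W^TX)$ and $\psi(W^TY)$ are integrable for $X\sim\mu^n$ and $Y\sim\mathcal{N}(0,1)^n$, and $$\left|\,\mathbb{E}_{X\sim\mu^n}[\psi(W^TX)]-\mathbb{E}_{Y\sim\mathcal{N}(0,1)^n}[\psi(W^TY)]\,\right|\le C\,\|\psi^{(4)}\|_1\,(\log k)^3\,\epsilon\log(1/\epsilon).$$ -/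

import Mathlib

open MeasureTheory ProbabilityTheory
open scoped ContDiff Matrix

/-- A distribution on `ℝ` is proper if, for `X ∼ μ`, the first three moments exist and
`E[X] = 0`, `E[X²] = 1`, `E[X³] = 0`. -/
structure IsProper (μ : Measure ℝ) : Prop where
  isProbabilityMeasure : IsProbabilityMeasure μ
  memLp_three : MemLp (fun x : ℝ => x) 3 μ
  moment_one : ∫ x, x ∂μ = 0
  moment_two : ∫ x, x ^ 2 ∂μ = 1
  moment_three : ∫ x, x ^ 3 ∂μ = 0

/-- A distribution on `ℝ` is hypercontractive if for some constant `c`, for all `m`, all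
`u ∈ ℝᵐ` and all real `q ≥ 2`, `‖⟨u, X⟩‖_q ≤ c √q ‖⟨u, X⟩‖_2` where `X ∼ μᵐ`.
The norms take values in `[0, ∞]`, so that nothing is said about a divergent moment by accident. -/
def IsHypercontractive (μ : Measure ℝ) : Prop :=
  ∃ c : ℝ, ∀ (m : ℕ) (u : Fin m → ℝ) (q : ℝ), 2 ≤ q →
    eLpNorm (fun x : Fin m → ℝ => u ⬝ᵥ x) (ENNReal.ofReal q) (Measure.pi fun _ => μ) ≤
      ENNReal.ofReal (c * √q) *
        eLpNorm (fun x : Fin m → ℝ => u ⬝ᵥ x) 2 (Measure.pi fun _ => μ)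

/-- A vector `u ∈ ℝⁿ` is `ε`-regular if `∑ uᵢ⁴ ≤ ε² ‖u‖²` (Euclidean norm). -/
def IsRegularVec {n : ℕ} (ε : ℝ) (u : Fin n → ℝ) : Prop :=
  ∑ i, u i ^ 4 ≤ ε ^ 2 * ‖WithLp.toLp 2 u‖ ^ 2

/-- A matrix is `ε`-regular if each of its columns is. -/
def IsRegularMatrix {n k : ℕ} (ε : ℝ) (W : Matrix (Fin n) (Fin k) ℝ) : Prop :=
  ∀ p, IsRegularVec ε (W.col p)

/-- The partial derivative `∂ₚ f`. -/
noncomputable def partialDeriv {k : ℕ} (p : Fin k) (f : (Fin k → ℝ) → ℝ) : (Fin k → ℝ) → ℝ :=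
  fun a => fderiv ℝ f a (Pi.single p 1)

/-- `‖ψ⁽⁴⁾‖₁ = sup_a ∑_{p,q,r,s} |∂ₚ∂_q∂_r∂ₛ ψ(a)|`, with values in `[0, ∞]`. -/
noncomputable def fourthDerivNorm {k : ℕ} (ψ : (Fin k → ℝ) → ℝ) : ENNReal :=
  ⨆ a : Fin k → ℝ, ENNReal.ofReal (∑ p, ∑ q, ∑ r, ∑ s,
    |partialDeriv p (partialDeriv q (partialDeriv r (partialDeriv s ψ))) a|)

/-! The proof is Lindeberg's replacement argument carried out in blocks. The rows of `W` are split
into colour classes, and the law `μ` is exchanged for the Gaussian one class at a time. In each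
exchange, `ψ` is expanded to third order around the contribution of the other rows. Both laws share
their first three moments, so the Taylor polynomials have equal means (`sameMean_taylorThree`). Only
the remainder is left, at most the derivative norm times the fourth power of the sup norm of the
block's contribution.

That contribution is a maximum of `k` subgaussian forms. If every column has squared mass at most `M
j` on class `j`, its fourth moment is `O((log k)² (M j)²)`, by taking `L^q` norms with `q` of order
`log k`. It remains to make `∑ j, M j ^ 2` small. Regularity and unit columns force every squared
entry below `ε`, so a random colouring with about `1 / (ε log k)` colours has, by a Chernoff bound,
masses of order `ε log k`, and the sum is `O(ε log k)` (`exists_balanced_colouring`). Together this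
gives `O((log k)³ ε)`. The factor `log (1 / ε)` is not needed: it is bounded below by `log (1 / ε₀)
> 0` and only changes the constant. -/

/-! ### Random colourings and balanced column masses -/

/-- Averaged over all colourings `h : Fin n → Fin T`, the exponential moment of the mass that a
weight `a` puts on the colour `j` factorizes. -/
lemma sum_exp_colour_eq {n T : ℕ} (a : Fin n → ℝ) (j : Fin T) :
    ∑ h : Fin n → Fin T, Real.exp (∑ i, if h i = j then a i else 0) =
      ∏ i, ((T : ℝ) - 1 + Real.exp (a i)) := by
  have hc : ∀ i, ((T : ℝ) - 1 + Real.exp (a i)) =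
      ∑ c : Fin T, Real.exp (if c = j then a i else 0) := by
    intro i
    rw [← Finset.add_sum_erase _ _ (Finset.mem_univ j)]
    rw [Finset.sum_congr rfl (g := fun _ => (1 : ℝ))
      (fun c hc => by simp [(Finset.mem_erase.mp hc).1])]
    have : 1 ≤ T := Nat.one_le_of_lt j.2
    simp [Finset.card_erase_of_mem, Nat.cast_sub this]
    ring
  simp_rw [hc, Finset.prod_univ_sum, Fintype.piFinset_univ, Real.exp_sum]

lemma exp_le_one_add_two_mul {x : ℝ} (h0 : 0 ≤ x) (h1 : x ≤ 1) : Real.exp x ≤ 1 + 2 * x := by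
  have h := Real.abs_exp_sub_one_sub_id_le (x := x) (by rw [abs_of_nonneg h0]; exact h1)
  have := (abs_le.mp h).2
  nlinarith

/-- Chernoff's estimate: each factor `T - 1 + exp (a i)` is at most `T (1 + 2 a i / T)`, hence at
most `T exp (2 a i / T)`. -/
lemma sum_exp_colour_le {n T : ℕ} (a : Fin n → ℝ) (h0 : ∀ i, 0 ≤ a i) (h1 : ∀ i, a i ≤ 1)
    (j : Fin T) :
    ∑ h : Fin n → Fin T, Real.exp (∑ i, if h i = j then a i else 0) ≤
      (T : ℝ) ^ n * Real.exp (2 * (∑ i, a i) / T) := by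
  have hT : (0 : ℝ) < T := by exact_mod_cast Nat.zero_lt_of_lt j.2
  have hT1 : (1 : ℝ) ≤ T := by exact_mod_cast Nat.one_le_of_lt j.2
  rw [sum_exp_colour_eq]
  calc ∏ i, ((T : ℝ) - 1 + Real.exp (a i)) ≤ ∏ i, ((T : ℝ) * Real.exp (2 * a i / T)) := by
        refine Finset.prod_le_prod (fun i _ => ?_) (fun i _ => ?_)
        · have := Real.exp_pos (a i); linarith
        · have h2 := exp_le_one_add_two_mul (h0 i) (h1 i)
          have h3 := Real.add_one_le_exp (2 * a i / T)
          have h4 : (T : ℝ) * (2 * a i / T + 1) = 2 * a i + T := by field_simp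
          nlinarith [mul_le_mul_of_nonneg_left h3 hT.le]
    _ = _ := by
        rw [Finset.prod_mul_distrib, ← Real.exp_sum, Finset.mul_sum, Finset.sum_div]
        simp

/-- Turns exponential moments into second moments. Above the threshold `L`, split `x = L + y` and
use `y² ≤ 2 exp y`; below it the first term suffices. -/
lemma sq_le_exp_sub {x L : ℝ} (hL : 0 ≤ L) (hx : 0 ≤ x) :
    x ^ 2 ≤ 2 * L ^ 2 + 4 * Real.exp (x - L) := by
  rcases le_total x L with h | h
  · nlinarith [Real.exp_pos (x - L)]
  · have := Real.quadratic_le_exp_of_nonneg (sub_nonneg.mpr h)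
    nlinarith [sq_nonneg (x - 2 * L), sq_nonneg (x - L)]

lemma half_le_log_natCast {k : ℕ} (hk : 2 ≤ k) : 1 / 2 ≤ Real.log k := by
  have h1 := Real.log_two_gt_d9
  have h2 : Real.log 2 ≤ Real.log k := Real.log_le_log (by norm_num) (by exact_mod_cast hk)
  linarith

/-- There is a colouring of the rows of a matrix `a` of nonnegative entries at most `ε` and with
column sums one, such that the maximal column masses `M j` of the colour classes have sum of
squares `O(ε log k)`. -/
lemma exists_balanced_colouring {n k : ℕ} (hk : 2 ≤ k) {ε : ℝ} (hε : 0 < ε)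
    (a : Fin n → Fin k → ℝ) (h0 : ∀ i p, 0 ≤ a i p) (h1 : ∀ i p, a i p ≤ ε)
    (hs : ∀ p, ∑ i, a i p = 1) :
    ∃ (T : ℕ) (h : Fin n → Fin T) (M : Fin T → ℝ), (∀ j, 0 ≤ M j) ∧
      (∀ j p, ∑ i, (if h i = j then a i p else 0) ≤ M j) ∧
      ∑ j, M j ^ 2 ≤ 100 * (ε * Real.log k) := by
  have hl := half_le_log_natCast hk
  have hk0 : (0 : ℝ) < k := by positivity
  have hεl : 0 < ε * Real.log k := by positivity
  -- When `ε log k ≥ 1` a single class of mass one already meets the bound.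
  rcases le_or_gt 1 (ε * Real.log k) with hc | hc
  · refine ⟨1, fun _ => 0, fun _ => 1, fun _ => zero_le_one, fun j p => ?_, ?_⟩
    · simp [Fin.fin_one_eq_zero j, hs p]
    · simp; linarith
  -- With this many colours the scaled mean mass `1 / (ε T)` is at most `log k`, so the Chernoff
  -- factor is at most `k²`; rounding up still leaves `T ε log k ≤ 2`.
  set T : ℕ := ⌈1 / (ε * Real.log k)⌉₊ with hTdef
  have hT1 : 1 / (ε * Real.log k) ≤ T := Nat.le_ceil _
  have hT2 : (T : ℝ) < 1 / (ε * Real.log k) + 1 := Nat.ceil_lt_add_one (by positivity)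
  have hinv : 1 < 1 / (ε * Real.log k) := by rw [lt_div_iff₀ hεl]; linarith
  have hTpos : (0 : ℝ) < T := by linarith
  have hTne : 0 < T := by exact_mod_cast hTpos
  have hTle : T * (ε * Real.log k) ≤ 2 := by
    have h2 : (T : ℝ) ≤ 2 / (ε * Real.log k) := by
      have : 2 / (ε * Real.log k) = 1 / (ε * Real.log k) + 1 / (ε * Real.log k) := by ring
      linarith
    rwa [le_div_iff₀ hεl] at h2
  set Z : (Fin n → Fin T) → Fin T → Fin k → ℝ :=
    fun h j p => ∑ i, if h i = j then a i p / ε else 0 with hZ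
  have hZ0 : ∀ h j p, 0 ≤ Z h j p := fun h j p => Finset.sum_nonneg fun i _ => by
    split_ifs
    · exact div_nonneg (h0 i p) hε.le
    · exact le_rfl
  have hcol : ∀ j p, ∑ h, Real.exp (Z h j p) ≤ (T : ℝ) ^ n * k ^ 2 := by
    intro j p
    refine (sum_exp_colour_le (fun i => a i p / ε) (fun i => div_nonneg (h0 i p) hε.le)
      (fun i => (div_le_one hε).2 (h1 i p)) j).trans ?_
    gcongr
    rw [← Finset.sum_div, hs p, ← Real.le_log_iff_exp_le (by positivity), Real.log_pow]
    rw [div_le_iff₀ hεl] at hT1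
    rw [div_le_iff₀ hTpos, mul_one_div, div_le_iff₀ hε]
    push_cast
    nlinarith
  -- Averaging over all `T ^ n` colourings controls the `T k` exponentials simultaneously, each of
  -- mean at most `k²`.
  obtain ⟨h, -, hh⟩ : ∃ h ∈ (Finset.univ : Finset (Fin n → Fin T)),
      ∑ j, ∑ p, Real.exp (Z h j p) ≤ T * k ^ 3 := by
    have : Nonempty (Fin T) := ⟨⟨0, hTne⟩⟩
    refine Finset.exists_le_of_sum_le Finset.univ_nonempty ?_
    rw [Finset.sum_comm]
    calc ∑ j, ∑ h, ∑ p, Real.exp (Z h j p) ≤ ∑ _j : Fin T, ∑ _p : Fin k, (T : ℝ) ^ n * k ^ 2 := by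
          refine Finset.sum_le_sum fun j _ => ?_
          rw [Finset.sum_comm]
          exact Finset.sum_le_sum fun p _ => hcol j p
      _ = _ := by simp; ring
  have hS : ∀ j, 1 ≤ ∑ p, Real.exp (Z h j p) := by
    intro j
    have hp : (⟨0, by omega⟩ : Fin k) ∈ (Finset.univ : Finset (Fin k)) := Finset.mem_univ _
    refine le_trans (Real.one_le_exp (hZ0 h j _))
      (Finset.single_le_sum (f := fun p => Real.exp (Z h j p)) (fun p _ => (Real.exp_pos _).le) hp)
  -- The soft maximum over the columns serves as `M j`: it dominates every column mass, and its
  -- exponential is the quantity just bounded.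
  refine ⟨T, h, fun j => ε * Real.log (∑ p, Real.exp (Z h j p)), fun j => ?_, fun j p => ?_, ?_⟩
  · exact mul_nonneg hε.le (Real.log_nonneg (hS j))
  · have : ∑ i, (if h i = j then a i p else 0) = ε * Z h j p := by
      simp only [hZ, Finset.mul_sum, mul_ite, mul_zero, mul_div_cancel₀ _ hε.ne']
    rw [this]
    refine mul_le_mul_of_nonneg_left ?_ hε.le
    rw [Real.le_log_iff_exp_le (by linarith [hS j])]
    exact Finset.single_le_sum (f := fun p => Real.exp (Z h j p)) (fun p _ => (Real.exp_pos _).le)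
      (Finset.mem_univ p)
  · have hj : ∀ j, (ε * Real.log (∑ p, Real.exp (Z h j p))) ^ 2 ≤
        ε ^ 2 * (2 * (3 * Real.log k) ^ 2 + 4 * ((∑ p, Real.exp (Z h j p)) / k ^ 3)) := by
      intro j
      rw [mul_pow]
      gcongr
      -- The threshold is `log (k³)`, so that the exponential excesses sum to at most `T` over the
      -- classes.
      have := sq_le_exp_sub (L := 3 * Real.log k) (by positivity) (Real.log_nonneg (hS j))
      rwa [Real.exp_sub, Real.exp_log (by linarith [hS j]),
        show (3 : ℝ) * Real.log k = Real.log ((k : ℝ) ^ 3) by rw [Real.log_pow]; norm_num,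
        Real.exp_log (by positivity), Real.log_pow] at this
    refine (Finset.sum_le_sum fun j _ => hj j).trans ?_
    rw [← Finset.mul_sum, Finset.sum_add_distrib, ← Finset.mul_sum Finset.univ _ 4,
      ← Finset.sum_div]
    have h5 : (∑ j, ∑ p, Real.exp (Z h j p)) / (k : ℝ) ^ 3 ≤ T := by
      rw [div_le_iff₀ (by positivity)]; exact hh
    simp only [Finset.sum_const, Finset.card_univ, Fintype.card_fin, nsmul_eq_mul]
    have h6 : (T : ℝ) * (2 * (3 * Real.log k) ^ 2) +
        4 * ((∑ j, ∑ p, Real.exp (Z h j p)) / (k : ℝ) ^ 3) ≤ T * (34 * Real.log k ^ 2) := by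
      nlinarith [mul_le_mul_of_nonneg_left (show 1 ≤ 4 * Real.log k ^ 2 by nlinarith) hTpos.le]
    calc _ ≤ ε ^ 2 * (T * (34 * Real.log k ^ 2)) := by gcongr
      _ = 34 * (ε * Real.log k) * (T * (ε * Real.log k)) := by ring
      _ ≤ 34 * (ε * Real.log k) * 2 := by gcongr
      _ ≤ _ := by nlinarith

/-! ### Third-order Taylor expansion -/

lemma ContDiff.partialDeriv {k : ℕ} {f : (Fin k → ℝ) → ℝ} (hf : ContDiff ℝ ∞ f) (p : Fin k) :
    ContDiff ℝ ∞ (partialDeriv p f) := by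
  unfold _root_.partialDeriv
  exact (hf.fderiv_right (m := ∞) (by simp)).clm_apply contDiff_const

lemma fderiv_apply_eq_sum_partialDeriv {k : ℕ} (f : (Fin k → ℝ) → ℝ) (a u : Fin k → ℝ) :
    fderiv ℝ f a u = ∑ p, u p * partialDeriv p f a := by
  conv_lhs => rw [← Finset.univ_sum_single u]
  rw [map_sum]
  refine Finset.sum_congr rfl fun p _ => ?_
  rw [partialDeriv, ← smul_eq_mul, ← map_smul]
  congr 1
  rw [← Pi.single_smul]; simp

lemma hasDerivAt_comp_line {k : ℕ} {f : (Fin k → ℝ) → ℝ} (hf : ContDiff ℝ ∞ f)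
    (v u : Fin k → ℝ) (t : ℝ) :
    HasDerivAt (fun t : ℝ => f (v + t • u)) (∑ p, u p * partialDeriv p f (v + t • u)) t := by
  have h1 : HasFDerivAt f (fderiv ℝ f (v + t • u)) (v + t • u) :=
    (hf.differentiable (by simp) _).hasFDerivAt
  have h2 : HasDerivAt (fun t : ℝ => v + t • u) u t := by
    simpa using ((hasDerivAt_id t).smul_const u).const_add v
  rw [← fderiv_apply_eq_sum_partialDeriv]
  exact h1.comp_hasDerivAt t h2

lemma abs_le_of_abs_deriv_le {f f' : ℝ → ℝ} {M : ℝ} (h0 : f 0 = 0)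
    (hf : ∀ t, HasDerivAt f (f' t) t) (hM : ∀ t ∈ Set.Icc (0 : ℝ) 1, |f' t| ≤ M) :
    ∀ t ∈ Set.Icc (0 : ℝ) 1, |f t| ≤ M := by
  intro t ht
  have h := (convex_Icc (0 : ℝ) 1).norm_image_sub_le_of_norm_hasDerivWithin_le
    (fun x _ => (hf x).hasDerivWithinAt) hM (Set.left_mem_Icc.2 zero_le_one) ht
  have hM0 : 0 ≤ M := (abs_nonneg _).trans (hM t ht)
  rw [h0, sub_zero, sub_zero, Real.norm_eq_abs, Real.norm_eq_abs, abs_of_nonneg ht.1] at h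
  nlinarith [ht.2]

/-- The bound on `g₄` is integrated four times. On `[0, 1]` each integration preserves it, which
gives the constant one; the sharper `1 / 24` is not sought. -/
lemma abs_taylor_three_le {g g₁ g₂ g₃ g₄ : ℝ → ℝ} {M : ℝ}
    (h₁ : ∀ t, HasDerivAt g (g₁ t) t) (h₂ : ∀ t, HasDerivAt g₁ (g₂ t) t)
    (h₃ : ∀ t, HasDerivAt g₂ (g₃ t) t) (h₄ : ∀ t, HasDerivAt g₃ (g₄ t) t)
    (hM : ∀ t, |g₄ t| ≤ M) :
    |g 1 - (g 0 + g₁ 0 + g₂ 0 / 2 + g₃ 0 / 6)| ≤ M := by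
  have hid : ∀ t : ℝ, HasDerivAt (fun t : ℝ => t) 1 t := fun t => hasDerivAt_id' t
  have r₃ : ∀ t ∈ Set.Icc (0 : ℝ) 1, |g₃ t - g₃ 0| ≤ M :=
    abs_le_of_abs_deriv_le (by simp) (fun t => (h₄ t).sub_const _) fun t _ => hM t
  have r₂ : ∀ t ∈ Set.Icc (0 : ℝ) 1, |g₂ t - (g₂ 0 + t * g₃ 0)| ≤ M := by
    refine abs_le_of_abs_deriv_le (by simp) (fun t => ?_) r₃
    refine HasDerivAt.congr_deriv ((h₃ t).fun_sub (((hid t).mul_const (g₃ 0)).const_add (g₂ 0))) ?_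
    ring
  have r₁ : ∀ t ∈ Set.Icc (0 : ℝ) 1, |g₁ t - (g₁ 0 + t * g₂ 0 + t ^ 2 / 2 * g₃ 0)| ≤ M := by
    refine abs_le_of_abs_deriv_le (by simp) (fun t => ?_) r₂
    refine HasDerivAt.congr_deriv ((h₂ t).fun_sub ((((hid t).mul_const (g₂ 0)).const_add (g₁ 0)).fun_add
      ((((hid t).fun_pow 2).div_const 2).mul_const (g₃ 0)))) ?_
    simp
  have r₀ : ∀ t ∈ Set.Icc (0 : ℝ) 1,
      |g t - (g 0 + t * g₁ 0 + t ^ 2 / 2 * g₂ 0 + t ^ 3 / 6 * g₃ 0)| ≤ M := by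
    refine abs_le_of_abs_deriv_le (by simp) (fun t => ?_) r₁
    refine HasDerivAt.congr_deriv ((h₁ t).fun_sub (((((hid t).mul_const (g₁ 0)).const_add (g 0)).fun_add
      ((((hid t).fun_pow 2).div_const 2).mul_const (g₂ 0))).fun_add
      ((((hid t).fun_pow 3).div_const 6).mul_const (g₃ 0)))) ?_
    push_cast; ring
  convert r₀ 1 (by simp) using 2
  ring

/-- The Taylor polynomial of degree three of `ψ` at `v`, as a function of the increment `u`. -/
noncomputable def taylorThree {k : ℕ} (ψ : (Fin k → ℝ) → ℝ) (v u : Fin k → ℝ) : ℝ :=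
  ψ v + ∑ s, u s * partialDeriv s ψ v +
    (∑ s, ∑ r, u s * u r * partialDeriv r (partialDeriv s ψ) v) / 2 +
    (∑ s, ∑ r, ∑ q, u s * u r * u q *
      partialDeriv q (partialDeriv r (partialDeriv s ψ)) v) / 6

lemma sum_abs_partialDeriv_le {k : ℕ} {ψ : (Fin k → ℝ) → ℝ} (hψ : fourthDerivNorm ψ < ⊤)
    (a : Fin k → ℝ) :
    ∑ p, ∑ q, ∑ r, ∑ s,
      |partialDeriv p (partialDeriv q (partialDeriv r (partialDeriv s ψ))) a| ≤
        (fourthDerivNorm ψ).toReal := by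
  rw [← ENNReal.ofReal_le_iff_le_toReal hψ.ne]
  exact le_iSup (fun a : Fin k → ℝ => ENNReal.ofReal (∑ p, ∑ q, ∑ r, ∑ s,
    |partialDeriv p (partialDeriv q (partialDeriv r (partialDeriv s ψ))) a|)) a

/-- Differentiating along a line produces the sums in the opposite order to `fourthDerivNorm`.
Exchanging sums suffices; symmetry of the derivatives plays no role. -/
lemma sum_four_reverse {k : ℕ} (F : Fin k → Fin k → Fin k → Fin k → ℝ) :
    ∑ s, ∑ r, ∑ q, ∑ p, F p q r s = ∑ p, ∑ q, ∑ r, ∑ s, F p q r s := by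
  calc ∑ s, ∑ r, ∑ q, ∑ p, F p q r s = ∑ s, ∑ r, ∑ p, ∑ q, F p q r s :=
        Finset.sum_congr rfl fun s _ => Finset.sum_congr rfl fun r _ => Finset.sum_comm
    _ = ∑ s, ∑ p, ∑ r, ∑ q, F p q r s := Finset.sum_congr rfl fun s _ => Finset.sum_comm
    _ = ∑ p, ∑ s, ∑ r, ∑ q, F p q r s := Finset.sum_comm
    _ = ∑ p, ∑ q, ∑ r, ∑ s, F p q r s := by
        refine Finset.sum_congr rfl fun p _ => ?_
        calc ∑ s, ∑ r, ∑ q, F p q r s = ∑ s, ∑ q, ∑ r, F p q r s :=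
              Finset.sum_congr rfl fun s _ => Finset.sum_comm
          _ = ∑ q, ∑ s, ∑ r, F p q r s := Finset.sum_comm
          _ = _ := Finset.sum_congr rfl fun q _ => Finset.sum_comm

/-- The `ℓ¹` norm of the fourth derivatives is paired with the sup norm of the increment, which is
the norm on `Fin k → ℝ`. -/
lemma abs_sub_taylorThree_le {k : ℕ} {ψ : (Fin k → ℝ) → ℝ} (hs : ContDiff ℝ ∞ ψ)
    (hψ : fourthDerivNorm ψ < ⊤) (v u : Fin k → ℝ) :
    |ψ (v + u) - taylorThree ψ v u| ≤ (fourthDerivNorm ψ).toReal * ‖u‖ ^ 4 := by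
  have key := abs_taylor_three_le (M := (fourthDerivNorm ψ).toReal * ‖u‖ ^ 4)
    (g := fun t => ψ (v + t • u))
    (g₁ := fun t => ∑ s, u s * partialDeriv s ψ (v + t • u))
    (g₂ := fun t => ∑ s, ∑ r, u s * u r * partialDeriv r (partialDeriv s ψ) (v + t • u))
    (g₃ := fun t => ∑ s, ∑ r, ∑ q, u s * u r * u q *
      partialDeriv q (partialDeriv r (partialDeriv s ψ)) (v + t • u))
    (g₄ := fun t => ∑ s, ∑ r, ∑ q, ∑ p, u s * u r * u q * u p *
      partialDeriv p (partialDeriv q (partialDeriv r (partialDeriv s ψ))) (v + t • u))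
    (fun t => hasDerivAt_comp_line hs v u t) (fun t => ?_) (fun t => ?_) (fun t => ?_) (fun t => ?_)
  · simpa [taylorThree] using key
  · refine HasDerivAt.fun_sum fun s _ => ?_
    refine HasDerivAt.congr_deriv ((hasDerivAt_comp_line (hs.partialDeriv s) v u t).const_mul (u s)) ?_
    simp only [Finset.mul_sum, mul_assoc]
  · refine HasDerivAt.fun_sum fun s _ => HasDerivAt.fun_sum fun r _ => ?_
    refine HasDerivAt.congr_deriv ((hasDerivAt_comp_line ((hs.partialDeriv s).partialDeriv r) v u t).const_mul
      (u s * u r)) ?_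
    simp only [Finset.mul_sum, mul_assoc]
  · refine HasDerivAt.fun_sum fun s _ => HasDerivAt.fun_sum fun r _ =>
      HasDerivAt.fun_sum fun q _ => ?_
    refine HasDerivAt.congr_deriv ((hasDerivAt_comp_line (((hs.partialDeriv s).partialDeriv r).partialDeriv q)
      v u t).const_mul (u s * u r * u q)) ?_
    simp only [Finset.mul_sum, mul_assoc]
  · have hu : ∀ p, |u p| ≤ ‖u‖ := fun p => norm_le_pi_norm u p
    calc _ ≤ ∑ s, ∑ r, ∑ q, ∑ p, ‖u‖ ^ 4 *
          |partialDeriv p (partialDeriv q (partialDeriv r (partialDeriv s ψ))) (v + t • u)| := by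
          refine (Finset.abs_sum_le_sum_abs _ _).trans (Finset.sum_le_sum fun s _ => ?_)
          refine (Finset.abs_sum_le_sum_abs _ _).trans (Finset.sum_le_sum fun r _ => ?_)
          refine (Finset.abs_sum_le_sum_abs _ _).trans (Finset.sum_le_sum fun q _ => ?_)
          refine (Finset.abs_sum_le_sum_abs _ _).trans (Finset.sum_le_sum fun p _ => ?_)
          rw [abs_mul, abs_mul, abs_mul, abs_mul]
          gcongr
          calc |u s| * |u r| * |u q| * |u p| ≤ ‖u‖ * ‖u‖ * ‖u‖ * ‖u‖ := by
                gcongr <;> exact hu _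
            _ = ‖u‖ ^ 4 := by ring
      _ = ‖u‖ ^ 4 * ∑ p, ∑ q, ∑ r, ∑ s,
          |partialDeriv p (partialDeriv q (partialDeriv r (partialDeriv s ψ))) (v + t • u)| := by
          rw [← sum_four_reverse]
          simp only [Finset.mul_sum]
      _ ≤ _ := by
          rw [mul_comm]
          gcongr
          exact sum_abs_partialDeriv_le hψ _

/-! ### Matching the first three moments -/

/-- The function `F` is integrable with respect to both measures, with the same integral. -/
def SameMean {Ω : Type*} [MeasurableSpace Ω] (P Q : Measure Ω) (F : Ω → ℝ) : Prop :=
  Integrable F P ∧ Integrable F Q ∧ ∫ x, F x ∂P = ∫ x, F x ∂Q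

namespace SameMean

variable {Ω : Type*} [MeasurableSpace Ω] {P Q : Measure Ω}

lemma add {F G : Ω → ℝ} (hF : SameMean P Q F) (hG : SameMean P Q G) :
    SameMean P Q (fun x => F x + G x) :=
  ⟨hF.1.add hG.1, hF.2.1.add hG.2.1, by
    rw [integral_add hF.1 hG.1, integral_add hF.2.1 hG.2.1, hF.2.2, hG.2.2]⟩

lemma mul_const {F : Ω → ℝ} (hF : SameMean P Q F) (c : ℝ) : SameMean P Q (fun x => F x * c) :=
  ⟨hF.1.mul_const c, hF.2.1.mul_const c, by
    rw [integral_mul_const, integral_mul_const, hF.2.2]⟩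

lemma div_const {F : Ω → ℝ} (hF : SameMean P Q F) (c : ℝ) : SameMean P Q (fun x => F x / c) := by
  simpa only [div_eq_mul_inv] using hF.mul_const c⁻¹

lemma sum {ι : Type*} {s : Finset ι} {F : ι → Ω → ℝ} (hF : ∀ i ∈ s, SameMean P Q (F i)) :
    SameMean P Q (fun x => ∑ i ∈ s, F i x) :=
  ⟨integrable_finsetSum _ fun i hi => (hF i hi).1, integrable_finsetSum _ fun i hi => (hF i hi).2.1,
    by
      rw [integral_finsetSum _ fun i hi => (hF i hi).1,
        integral_finsetSum _ fun i hi => (hF i hi).2.1]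
      exact Finset.sum_congr rfl fun i hi => (hF i hi).2.2⟩

lemma const [IsProbabilityMeasure P] [IsProbabilityMeasure Q] (c : ℝ) :
    SameMean P Q (fun _ => c) :=
  ⟨integrable_const c, integrable_const c, by simp⟩

end SameMean

lemma IsProper.integrable_pow {μ : Measure ℝ} (hμ : IsProper μ) {e : ℕ} (he : e ≤ 3) :
    Integrable (fun x : ℝ => x ^ e) μ := by
  have := hμ.isProbabilityMeasure
  rcases Nat.eq_zero_or_pos e with rfl | h0
  · simp
  have h : MemLp (fun x : ℝ => x) e μ := hμ.memLp_three.mono_exponent (by exact_mod_cast he)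
  have h2 := h.integrable_norm_pow h0.ne'
  refine h2.mono' (by fun_prop) (Filter.Eventually.of_forall fun x => by simp)

lemma isProper_gaussianReal : IsProper (gaussianReal 0 1) where
  isProbabilityMeasure := inferInstance
  memLp_three := memLp_id_gaussianReal (μ := 0) (v := 1) 3
  moment_one := integral_id_gaussianReal
  moment_two := by
    have h := variance_id_gaussianReal (μ := 0) (v := 1)
    rw [variance_eq_integral aemeasurable_id] at h
    simpa using h
  moment_three := by
    have h : ∫ x, x ^ 3 ∂(gaussianReal 0 1) = ∫ x, (-x) ^ 3 ∂(gaussianReal 0 1) := by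
      conv_lhs => rw [show (0 : ℝ) = -0 by simp, ← gaussianReal_map_neg]
      rw [integral_map (by fun_prop) (by fun_prop)]
    have h2 : ∫ x, (-x) ^ 3 ∂(gaussianReal 0 1) = - ∫ x, x ^ 3 ∂(gaussianReal 0 1) := by
      rw [← integral_neg]
      congr 1; ext x; ring
    linarith

lemma IsProper.integral_pow_eq {μ ν : Measure ℝ} (hμ : IsProper μ) (hν : IsProper ν) {e : ℕ}
    (he : e ≤ 3) : ∫ x, x ^ e ∂μ = ∫ x, x ^ e ∂ν := by
  have := hμ.isProbabilityMeasure
  have := hν.isProbabilityMeasure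
  interval_cases e
  · simp
  · simp [hμ.moment_one, hν.moment_one]
  · rw [hμ.moment_two, hν.moment_two]
  · rw [hμ.moment_three, hν.moment_three]

/-- Independence factorizes a monomial over coordinates, and each factor is a moment of order at
most three. -/
lemma sameMean_prod_pow {μ ν : Measure ℝ} (hμ : IsProper μ) (hν : IsProper ν) {n : ℕ}
    (e : Fin n → ℕ) (he : ∀ i, e i ≤ 3) :
    SameMean (Measure.pi fun _ => μ) (Measure.pi fun _ => ν)
      (fun x : Fin n → ℝ => ∏ i, x i ^ e i) := by
  have := hμ.isProbabilityMeasure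
  have := hν.isProbabilityMeasure
  refine ⟨Integrable.fintype_prod (f := fun i (y : ℝ) => y ^ e i) fun i => hμ.integrable_pow (he i),
    Integrable.fintype_prod (f := fun i (y : ℝ) => y ^ e i) fun i => hν.integrable_pow (he i), ?_⟩
  rw [integral_fintype_prod_eq_prod (fun i (y : ℝ) => y ^ e i),
    integral_fintype_prod_eq_prod (fun i (y : ℝ) => y ^ e i)]
  exact Finset.prod_congr rfl fun i _ => hμ.integral_pow_eq hν (he i)

lemma sameMean_coord {μ ν : Measure ℝ} (hμ : IsProper μ) (hν : IsProper ν) {n : ℕ}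
    (i : Fin n) :
    SameMean (Measure.pi fun _ => μ) (Measure.pi fun _ => ν) (fun x : Fin n → ℝ => x i) := by
  convert sameMean_prod_pow hμ hν (fun a => if a = i then 1 else 0)
    (fun a => by split_ifs <;> simp) using 2 with x
  simp [pow_ite]

lemma sameMean_coord_mul {μ ν : Measure ℝ} (hμ : IsProper μ) (hν : IsProper ν) {n : ℕ}
    (i j : Fin n) :
    SameMean (Measure.pi fun _ => μ) (Measure.pi fun _ => ν)
      (fun x : Fin n → ℝ => x i * x j) := by
  convert sameMean_prod_pow hμ hν (fun a => (if a = i then 1 else 0) + (if a = j then 1 else 0))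
    (fun a => by split_ifs <;> simp) using 2 with x
  simp only [pow_add, pow_ite, pow_one, pow_zero, Finset.prod_mul_distrib, Finset.prod_ite_eq',
    Finset.mem_univ, if_true]

lemma sameMean_coord_mul_mul {μ ν : Measure ℝ} (hμ : IsProper μ) (hν : IsProper ν) {n : ℕ}
    (i j l : Fin n) :
    SameMean (Measure.pi fun _ => μ) (Measure.pi fun _ => ν)
      (fun x : Fin n → ℝ => x i * x j * x l) := by
  convert sameMean_prod_pow hμ hν (fun a => (if a = i then 1 else 0) + (if a = j then 1 else 0) +
    (if a = l then 1 else 0)) (fun a => by split_ifs <;> simp) using 2 with x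
  simp only [pow_add, pow_ite, pow_one, pow_zero, Finset.prod_mul_distrib, Finset.prod_ite_eq',
    Finset.mem_univ, if_true]

/-- The polynomial has total degree three in `x`, so even with coinciding indices no coordinate
occurs with exponent above three. -/
lemma sameMean_taylorThree {μ ν : Measure ℝ} (hμ : IsProper μ) (hν : IsProper ν) {n k : ℕ}
    (ψ : (Fin k → ℝ) → ℝ) (V : Matrix (Fin n) (Fin k) ℝ)
    (v : Fin k → ℝ) :
    SameMean (Measure.pi fun _ => μ) (Measure.pi fun _ => ν)
      (fun x : Fin n → ℝ => taylorThree ψ v (Vᵀ *ᵥ x)) := by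
  have := hμ.isProbabilityMeasure
  have := hν.isProbabilityMeasure
  have h1 : ∀ s, SameMean (Measure.pi fun _ => μ) (Measure.pi fun _ => ν)
      (fun x : Fin n → ℝ => (Vᵀ *ᵥ x) s) := by
    intro s
    have := SameMean.sum (s := Finset.univ) fun i _ => (sameMean_coord hμ hν i).mul_const (V i s)
    convert this using 2 with x
    simp [Matrix.mulVec, dotProduct, mul_comm]
  have h2 : ∀ s r, SameMean (Measure.pi fun _ => μ) (Measure.pi fun _ => ν)
      (fun x : Fin n → ℝ => (Vᵀ *ᵥ x) s * (Vᵀ *ᵥ x) r) := by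
    intro s r
    have := SameMean.sum (s := Finset.univ) fun i _ => SameMean.sum (s := Finset.univ) fun j _ =>
      (sameMean_coord_mul hμ hν i j).mul_const (V i s * V j r)
    convert this using 2 with x
    simp only [Matrix.mulVec, dotProduct, Finset.sum_mul_sum, Matrix.transpose_apply]
    exact Finset.sum_congr rfl fun i _ => Finset.sum_congr rfl fun j _ => by ring
  have h3 : ∀ s r q, SameMean (Measure.pi fun _ => μ) (Measure.pi fun _ => ν)
      (fun x : Fin n → ℝ => (Vᵀ *ᵥ x) s * (Vᵀ *ᵥ x) r * (Vᵀ *ᵥ x) q) := by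
    intro s r q
    have := SameMean.sum (s := Finset.univ) fun i _ => SameMean.sum (s := Finset.univ) fun j _ =>
      SameMean.sum (s := Finset.univ) fun l _ =>
      (sameMean_coord_mul_mul hμ hν i j l).mul_const (V i s * V j r * V l q)
    convert this using 2 with x
    simp only [Matrix.mulVec, dotProduct, Matrix.transpose_apply]
    rw [Finset.sum_mul_sum, Finset.sum_mul]
    refine Finset.sum_congr rfl fun i _ => ?_
    rw [Finset.sum_mul_sum]
    exact Finset.sum_congr rfl fun j _ => Finset.sum_congr rfl fun l _ => by ring
  unfold taylorThree
  refine (((SameMean.const _).add (SameMean.sum fun s _ => (h1 s).mul_const _)).add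
    ((SameMean.sum fun s _ => SameMean.sum fun r _ => (h2 s r).mul_const _).div_const 2)).add
    ((SameMean.sum fun s _ => SameMean.sum fun r _ => SameMean.sum fun q _ =>
      (h3 s r q).mul_const _).div_const 6)

/-! ### Subgaussian bounds for linear forms -/

lemma eLpNorm_le_ofReal_iff {Ω E : Type*} [MeasurableSpace Ω] [NormedAddCommGroup E]
    {P : Measure Ω} {f : Ω → E} {q B : ℝ} (hq : 0 < q) (hB : 0 ≤ B) :
    eLpNorm f (ENNReal.ofReal q) P ≤ ENNReal.ofReal B ↔
      ∫⁻ x, ‖f x‖ₑ ^ q ∂P ≤ ENNReal.ofReal (B ^ q) := by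
  rw [eLpNorm_eq_lintegral_rpow_enorm_toReal (by simpa using hq) ENNReal.ofReal_ne_top,
    ENNReal.toReal_ofReal hq.le, one_div, ENNReal.rpow_inv_le_iff hq,
    ENNReal.ofReal_rpow_of_nonneg hB hq.le]

/-- Linear forms in independent variables of law `ν` have `L^q` norm at most `c √q` times the
Euclidean norm of their coefficients. -/
def HasSubgaussianForms (c : ℝ) (ν : Measure ℝ) : Prop :=
  ∀ (m : ℕ) (u : Fin m → ℝ) (q : ℝ), 2 ≤ q →
    eLpNorm (fun x : Fin m → ℝ => u ⬝ᵥ x) (ENNReal.ofReal q) (Measure.pi fun _ => ν) ≤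
      ENNReal.ofReal (c * √q * √(∑ i, u i ^ 2))

/-- Independent centred coordinates of unit variance have additive variances; this replaces the `L²`
norm in hypercontractivity by the Euclidean norm of `u`. -/
lemma IsProper.eLpNorm_two_le {μ : Measure ℝ} (hμ : IsProper μ) {m : ℕ} (u : Fin m → ℝ) :
    eLpNorm (fun x : Fin m → ℝ => u ⬝ᵥ x) 2 (Measure.pi fun _ => μ) ≤
      ENNReal.ofReal (√(∑ i, u i ^ 2)) := by
  have := hμ.isProbabilityMeasure
  have h2 : MemLp (fun x : ℝ => x) 2 μ := hμ.memLp_three.mono_exponent (by norm_num)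
  have hcoord : ∀ i : Fin m, MemLp (fun x : Fin m → ℝ => x i) 2 (Measure.pi fun _ => μ) :=
    fun i => h2.comp_measurePreserving (measurePreserving_eval (fun _ => μ) i)
  have hmem : MemLp (fun x : Fin m → ℝ => u ⬝ᵥ x) 2 (Measure.pi fun _ => μ) :=
    memLp_finsetSum _ fun i _ => (hcoord i).const_mul (u i)
  have hvar1 : Var[fun x : ℝ => x; μ] = 1 := by
    rw [variance_of_integral_eq_zero (by fun_prop) hμ.moment_one, hμ.moment_two]
  have hmean : ∫ x : Fin m → ℝ, u ⬝ᵥ x ∂(Measure.pi fun _ => μ) = 0 := by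
    simp only [dotProduct]
    rw [integral_finsetSum _ fun i _ => ((hcoord i).integrable (by norm_num)).const_mul (u i)]
    refine Finset.sum_eq_zero fun i _ => ?_
    rw [integral_const_mul]
    have := (measurePreserving_eval (fun _ : Fin m => μ) i).map_eq
    have h3 : ∫ x : Fin m → ℝ, x i ∂(Measure.pi fun _ => μ) = ∫ x, x ∂μ := by
      conv_rhs => rw [← this]
      rw [integral_map (measurable_pi_apply i).aemeasurable (by fun_prop)]
    rw [h3, hμ.moment_one, mul_zero]
  have hint : ∫ x : Fin m → ℝ, (u ⬝ᵥ x) ^ 2 ∂(Measure.pi fun _ => μ) = ∑ i, u i ^ 2 := by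
    rw [← variance_of_integral_eq_zero hmem.aestronglyMeasurable.aemeasurable hmean]
    have h := variance_sum_pi (μ := fun _ : Fin m => μ) (X := fun i x => u i * x)
      fun i => h2.const_mul (u i)
    have h4 : ∀ i, Var[fun x : ℝ => u i * x; μ] = u i ^ 2 := fun i => by
      rw [variance_const_mul, hvar1, mul_one]
    simp only [h4] at h
    rw [← h]
    congr 1
    ext x; simp [dotProduct]
  rw [hmem.eLpNorm_eq_integral_rpow_norm (by norm_num) (by norm_num)]
  simp only [ENNReal.toReal_ofNat, Real.rpow_ofNat, Real.norm_eq_abs, sq_abs, hint]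
  rw [Real.sqrt_eq_rpow]; norm_num

lemma IsHypercontractive.exists_hasSubgaussianForms {μ : Measure ℝ} (hμ : IsProper μ)
    (hμ' : IsHypercontractive μ) : ∃ c, 0 ≤ c ∧ HasSubgaussianForms c μ := by
  obtain ⟨c, hc⟩ := hμ'
  refine ⟨max c 0, le_max_right _ _, fun m u q hq => (hc m u q hq).trans ?_⟩
  rw [ENNReal.ofReal_mul (mul_nonneg (le_max_right _ _) (Real.sqrt_nonneg _))]
  refine mul_le_mul' (ENNReal.ofReal_le_ofReal ?_) (hμ.eLpNorm_two_le u)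
  exact mul_le_mul_of_nonneg_right (le_max_left _ _) (Real.sqrt_nonneg _)

lemma integral_exp_dotProduct_gaussianReal {m : ℕ} (u : Fin m → ℝ) :
    Integrable (fun x : Fin m → ℝ => Real.exp (u ⬝ᵥ x)) (Measure.pi fun _ => gaussianReal 0 1) ∧
    ∫ x : Fin m → ℝ, Real.exp (u ⬝ᵥ x) ∂(Measure.pi fun _ => gaussianReal 0 1) =
      Real.exp ((∑ i, u i ^ 2) / 2) := by
  simp only [dotProduct, Real.exp_sum]
  refine ⟨Integrable.fintype_prod (f := fun i (y : ℝ) => Real.exp (u i * y))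
    fun i => integrable_exp_mul_gaussianReal (u i), ?_⟩
  rw [integral_fintype_prod_eq_prod (fun i (y : ℝ) => Real.exp (u i * y)), Finset.sum_div,
    Real.exp_sum]
  refine Finset.prod_congr rfl fun i _ => ?_
  have h := mgf_gaussianReal (p := gaussianReal 0 1) (X := id) Measure.map_id (u i)
  simpa [mgf] using h

/-- Raise `|y| ≤ (q / l) exp (l |y| / q)` to the power `q`. The parameter `l` is left free to be
optimized. -/
lemma abs_rpow_le_exp {q l y : ℝ} (hq : 0 < q) (hl : 0 < l) :
    |y| ^ q ≤ (q / l) ^ q * (Real.exp (l * y) + Real.exp (-(l * y))) := by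
  have h1 : |y| ≤ q / l * Real.exp (l * |y| / q) := by
    have h := Real.add_one_le_exp (l * |y| / q)
    have : |y| = q / l * (l * |y| / q) := by field_simp
    calc |y| = q / l * (l * |y| / q) := this
      _ ≤ _ := by gcongr; linarith
  calc |y| ^ q ≤ (q / l * Real.exp (l * |y| / q)) ^ q := by gcongr
    _ = (q / l) ^ q * Real.exp (l * |y|) := by
        rw [Real.mul_rpow (by positivity) (Real.exp_pos _).le, ← Real.exp_mul]
        congr 2; field_simp
    _ ≤ _ := by
        gcongr
        rcases abs_cases y with ⟨h, -⟩ | ⟨h, -⟩ <;> rw [h]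
        · linarith [Real.exp_pos (-(l * y))]
        · rw [mul_neg]; linarith [Real.exp_pos (l * y)]

lemma hasSubgaussianForms_gaussianReal : HasSubgaussianForms 4 (gaussianReal 0 1) := by
  intro m u q hq
  have hq0 : 0 < q := by linarith
  set σ := √(∑ i, u i ^ 2) with hσ
  have hσ2 : σ ^ 2 = ∑ i, u i ^ 2 := Real.sq_sqrt (Finset.sum_nonneg fun i _ => sq_nonneg _)
  rcases (Real.sqrt_nonneg (∑ i, u i ^ 2)).eq_or_lt with h0 | h0
  · have hu : u = 0 := by
      rw [← hσ] at h0
      rw [← h0] at hσ2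
      ext i
      have := (Finset.sum_eq_zero_iff_of_nonneg fun i _ => sq_nonneg (u i)).1
        (by rw [← hσ2]; norm_num) i (Finset.mem_univ i)
      simpa using this
    simp [hu]
  rw [← hσ] at h0
  rw [eLpNorm_le_ofReal_iff hq0 (by positivity)]
  -- This scaling makes both exponential moments equal to `exp (q / 2)`; then `2 exp (q / 2) ≤ 4 ^
  -- q` yields the constant `4`.
  set l := √q / σ with hl
  have hsq : 0 < √q := Real.sqrt_pos.2 hq0
  have hsq2 : √q ^ 2 = q := Real.sq_sqrt hq0.le
  have hl0 : 0 < l := by positivity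
  have hlu : ∑ i, (l • u) i ^ 2 = q := by
    simp only [Pi.smul_apply, smul_eq_mul, mul_pow, ← Finset.mul_sum, ← hσ2, hl]
    rw [div_pow, hsq2]; field_simp
  obtain ⟨hi1, he1⟩ := integral_exp_dotProduct_gaussianReal (l • u)
  obtain ⟨hi2, he2⟩ := integral_exp_dotProduct_gaussianReal (-(l • u))
  rw [hlu] at he1
  simp only [Pi.neg_apply, neg_sq, hlu] at he2
  simp only [neg_dotProduct, smul_dotProduct, smul_eq_mul] at hi1 hi2 he1 he2
  calc ∫⁻ x, ‖u ⬝ᵥ x‖ₑ ^ q ∂(Measure.pi fun _ => gaussianReal 0 1)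
      ≤ ∫⁻ x, ENNReal.ofReal ((q / l) ^ q *
          (Real.exp (l * (u ⬝ᵥ x)) + Real.exp (-(l * (u ⬝ᵥ x)))))
          ∂(Measure.pi fun _ => gaussianReal 0 1) := by
        refine lintegral_mono fun x => ?_
        rw [← ofReal_norm, ENNReal.ofReal_rpow_of_nonneg (norm_nonneg _) hq0.le]
        exact ENNReal.ofReal_le_ofReal (abs_rpow_le_exp hq0 hl0)
    _ = ENNReal.ofReal ((q / l) ^ q * (Real.exp (q / 2) + Real.exp (q / 2))) := by
        have hi : Integrable (fun x : Fin m → ℝ => (q / l) ^ q *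
            (Real.exp (l * (u ⬝ᵥ x)) + Real.exp (-(l * (u ⬝ᵥ x)))))
            (Measure.pi fun _ => gaussianReal 0 1) := (hi1.add hi2).const_mul _
        rw [← ofReal_integral_eq_lintegral_ofReal hi
          (Filter.Eventually.of_forall fun x => by positivity), integral_const_mul,
          integral_add hi1 hi2, he1, he2]
    _ ≤ ENNReal.ofReal ((4 * √q * σ) ^ q) := by
        refine ENNReal.ofReal_le_ofReal ?_
        have e1 : q / l = √q * σ := by
          rw [hl]; field_simp; exact hsq2.symm
        have e2 : Real.exp (q / 2) ≤ 2 ^ q := by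
          rw [show q / 2 = (1 / 2) * q by ring, Real.exp_mul]
          gcongr
          have := exp_le_one_add_two_mul (x := 1 / 2) (by norm_num) (by norm_num)
          linarith
        have e3 : (2 : ℝ) ≤ 2 ^ q := by
          simpa using Real.rpow_le_rpow_of_exponent_le (x := 2) (by norm_num)
            (show (1 : ℝ) ≤ q by linarith)
        rw [e1, show 4 * √q * σ = (√q * σ) * (2 * 2) by ring,
          Real.mul_rpow (x := √q * σ) (by positivity) (by norm_num),
          Real.mul_rpow (x := 2) (by norm_num) (by norm_num)]
        gcongr
        nlinarith [Real.exp_pos (q / 2)]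

lemma HasSubgaussianForms.memLp_id {c : ℝ} {ν : Measure ℝ} [IsProbabilityMeasure ν]
    (h : HasSubgaussianForms c ν) : MemLp (fun x : ℝ => x) 4 ν := by
  refine ⟨by fun_prop, ?_⟩
  have h1 := (h 1 (fun _ => 1) 4 (by norm_num)).trans_lt ENNReal.ofReal_lt_top
  have h2 := eLpNorm_comp_measurePreserving (p := 4) (f := Function.eval (0 : Fin 1))
    (g := fun x : ℝ => x) (by fun_prop) (measurePreserving_eval (fun _ : Fin 1 => ν) 0)
  rw [← h2]
  simpa [dotProduct, Function.comp_def] using h1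

/-! ### Fourth moment of a maximum of linear forms -/

lemma memLp_mulVec {n k : ℕ} (ν : Fin n → Measure ℝ) [∀ i, IsProbabilityMeasure (ν i)]
    (hν : ∀ i, MemLp (fun x : ℝ => x) 4 (ν i)) (V : Matrix (Fin n) (Fin k) ℝ) :
    MemLp (fun x : Fin n → ℝ => Vᵀ *ᵥ x) 4 (Measure.pi ν) := by
  rw [memLp_pi_iff]
  intro p
  have hcoord : ∀ i, MemLp (fun x : Fin n → ℝ => x i) 4 (Measure.pi ν) :=
    fun i => (hν i).comp_measurePreserving (measurePreserving_eval ν i)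
  have := memLp_finsetSum (Finset.univ : Finset (Fin n)) fun i _ => (hcoord i).const_mul (V i p)
  simpa only [Matrix.mulVec, dotProduct, Matrix.transpose_apply] using this

/-- The maximum of `k` linear forms has fourth moment `O((log k)²)`. -/
lemma HasSubgaussianForms.integral_norm_mulVec_le {c : ℝ} (hc : 0 ≤ c) {ν : Measure ℝ}
    [IsProbabilityMeasure ν] (h : HasSubgaussianForms c ν) {n k : ℕ} (hk : 2 ≤ k)
    (V : Matrix (Fin n) (Fin k) ℝ) {M : ℝ} (hM : 0 ≤ M) (hV : ∀ p, ∑ i, V i p ^ 2 ≤ M) :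
    ∫ x : Fin n → ℝ, ‖Vᵀ *ᵥ x‖ ^ 4 ∂(Measure.pi fun _ => ν) ≤
      (144 * Real.exp 4 * c ^ 4) * Real.log k ^ 2 * M ^ 2 := by
  have hl := half_le_log_natCast hk
  have hk0 : (0 : ℝ) < k := by positivity
  -- Here `q ≥ 4` and `k ≤ exp q`, so bounding the maximum by the sum over `k` forms costs only a
  -- factor `exp 1` in `L^q`.
  set q := 4 * (1 + Real.log k) with hq
  have hq4 : 4 ≤ q := by linarith
  have hq0 : 0 < q := by linarith
  set B := c * √q * √M with hB
  have hB0 : 0 ≤ B := by positivity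
  have hmem := memLp_mulVec (fun _ : Fin n => ν) (fun _ => h.memLp_id) V
  have hp : ∀ p, ∫⁻ x : Fin n → ℝ, ‖(Vᵀ *ᵥ x) p‖ₑ ^ q ∂(Measure.pi fun _ => ν) ≤
      ENNReal.ofReal (B ^ q) := by
    intro p
    rw [← eLpNorm_le_ofReal_iff hq0 hB0]
    refine (h n (fun i => V i p) q (by linarith)).trans (ENNReal.ofReal_le_ofReal ?_)
    rw [hB]
    gcongr
    exact hV p
  have hnorm : eLpNorm (fun x : Fin n → ℝ => Vᵀ *ᵥ x) (ENNReal.ofReal q)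
      (Measure.pi fun _ => ν) ≤ ENNReal.ofReal (Real.exp 1 * B) := by
    rw [eLpNorm_le_ofReal_iff hq0 (by positivity)]
    calc ∫⁻ x : Fin n → ℝ, ‖Vᵀ *ᵥ x‖ₑ ^ q ∂(Measure.pi fun _ => ν)
        ≤ ∫⁻ x : Fin n → ℝ, ∑ p, ‖(Vᵀ *ᵥ x) p‖ₑ ^ q ∂(Measure.pi fun _ => ν) := by
          refine lintegral_mono fun x => ?_
          have : Nonempty (Fin k) := ⟨⟨0, by omega⟩⟩
          obtain ⟨p, hp⟩ : ∃ p, ‖Vᵀ *ᵥ x‖ = ‖(Vᵀ *ᵥ x) p‖ := by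
            obtain ⟨p, -, hp⟩ := Finset.exists_mem_eq_sup' Finset.univ_nonempty
              (fun p => ‖(Vᵀ *ᵥ x) p‖₊)
            refine ⟨p, ?_⟩
            rw [Pi.norm_def, ← Finset.sup'_eq_sup Finset.univ_nonempty, hp, coe_nnnorm]
          rw [← ofReal_norm, hp, ofReal_norm]
          exact Finset.single_le_sum (f := fun p => ‖(Vᵀ *ᵥ x) p‖ₑ ^ q)
            (fun _ _ => zero_le) (Finset.mem_univ p)
      _ = ∑ p, ∫⁻ x : Fin n → ℝ, ‖(Vᵀ *ᵥ x) p‖ₑ ^ q ∂(Measure.pi fun _ => ν) := by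
          refine lintegral_finsetSum _ fun p _ => ?_
          have : Measurable fun x : Fin n → ℝ => (Vᵀ *ᵥ x) p := by
            simp only [Matrix.mulVec, dotProduct]; fun_prop
          fun_prop
      _ ≤ ∑ _p : Fin k, ENNReal.ofReal (B ^ q) := Finset.sum_le_sum fun p _ => hp p
      _ = ENNReal.ofReal (k * B ^ q) := by
          rw [ENNReal.ofReal_mul hk0.le]; simp
      _ ≤ _ := by
          refine ENNReal.ofReal_le_ofReal ?_
          rw [Real.mul_rpow (Real.exp_pos 1).le hB0, ← Real.exp_mul, one_mul]
          gcongr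
          rw [← Real.log_le_iff_le_exp hk0]
          linarith
  have h4 : eLpNorm (fun x : Fin n → ℝ => Vᵀ *ᵥ x) 4 (Measure.pi fun _ => ν) ≤
      ENNReal.ofReal (Real.exp 1 * B) := by
    refine (eLpNorm_le_eLpNorm_of_exponent_le ?_ hmem.aestronglyMeasurable).trans hnorm
    rw [← ENNReal.ofReal_ofNat]
    exact ENNReal.ofReal_le_ofReal hq4
  rw [hmem.eLpNorm_eq_integral_rpow_norm (by norm_num) (by norm_num),
    ENNReal.ofReal_le_ofReal_iff (by positivity)] at h4
  simp only [ENNReal.toReal_ofNat, Real.rpow_ofNat] at h4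
  have hI : 0 ≤ ∫ x : Fin n → ℝ, ‖Vᵀ *ᵥ x‖ ^ 4 ∂(Measure.pi fun _ => ν) :=
    integral_nonneg fun x => by positivity
  rw [Real.rpow_inv_le_iff_of_pos hI (by positivity) (by norm_num), Real.rpow_ofNat] at h4
  refine h4.trans ?_
  have e1 : √q ^ 4 = q ^ 2 := by
    rw [show (4 : ℕ) = 2 * 2 from rfl, pow_mul, Real.sq_sqrt hq0.le]
  have e2 : √M ^ 4 = M ^ 2 := by
    rw [show (4 : ℕ) = 2 * 2 from rfl, pow_mul, Real.sq_sqrt hM]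
  have e3 : Real.exp 1 ^ 4 = Real.exp 4 := by rw [← Real.exp_nat_mul]; norm_num
  calc (Real.exp 1 * B) ^ 4 = Real.exp 4 * c ^ 4 * q ^ 2 * M ^ 2 := by
        rw [hB, mul_pow, mul_pow, mul_pow, e1, e2, e3]; ring
    -- Since `log k ≥ 1 / 2`, `q ≤ 12 log k`.
    _ ≤ Real.exp 4 * c ^ 4 * (12 * Real.log k) ^ 2 * M ^ 2 := by
        gcongr
        linarith
    _ = _ := by ring

/-! ### Integrability from quartic growth -/

lemma abs_taylorThree_zero_le {k : ℕ} (ψ : (Fin k → ℝ) → ℝ) :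
    ∃ A, 0 ≤ A ∧ ∀ u : Fin k → ℝ, |taylorThree ψ 0 u| ≤ A * (1 + ‖u‖ ^ 4) := by
  refine ⟨|ψ 0| + (∑ s, |partialDeriv s ψ 0|) +
    (∑ s, ∑ r, |partialDeriv r (partialDeriv s ψ) 0|) +
    (∑ s, ∑ r, ∑ q, |partialDeriv q (partialDeriv r (partialDeriv s ψ)) 0|),
    by positivity, fun u => ?_⟩
  have hu : ∀ p, |u p| ≤ ‖u‖ := fun p => norm_le_pi_norm u p
  set t := ‖u‖ with ht
  have t0 : 0 ≤ t := norm_nonneg u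
  have b1 : t ≤ 1 + t ^ 4 := by nlinarith [sq_nonneg (t ^ 2 - 1), sq_nonneg (t - 1)]
  have b2 : t * t ≤ 1 + t ^ 4 := by nlinarith [sq_nonneg (t ^ 2 - 1)]
  have b3 : t * t * t ≤ 1 + t ^ 4 := by
    nlinarith [sq_nonneg (t ^ 2 - t), sq_nonneg (t ^ 2 - 1), sq_nonneg t]
  have c1 : |∑ s, u s * partialDeriv s ψ 0| ≤ (∑ s, |partialDeriv s ψ 0|) * (1 + t ^ 4) := by
    rw [Finset.sum_mul]
    refine (Finset.abs_sum_le_sum_abs _ _).trans (Finset.sum_le_sum fun s _ => ?_)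
    rw [abs_mul, mul_comm]
    gcongr
    exact (hu s).trans b1
  have c2 : |∑ s, ∑ r, u s * u r * partialDeriv r (partialDeriv s ψ) 0| ≤
      (∑ s, ∑ r, |partialDeriv r (partialDeriv s ψ) 0|) * (1 + t ^ 4) := by
    simp only [Finset.sum_mul]
    refine (Finset.abs_sum_le_sum_abs _ _).trans (Finset.sum_le_sum fun s _ => ?_)
    refine (Finset.abs_sum_le_sum_abs _ _).trans (Finset.sum_le_sum fun r _ => ?_)
    rw [abs_mul, abs_mul, mul_comm]
    gcongr
    exact (mul_le_mul (hu s) (hu r) (abs_nonneg _) t0).trans b2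
  have c3 : |∑ s, ∑ r, ∑ q, u s * u r * u q *
      partialDeriv q (partialDeriv r (partialDeriv s ψ)) 0| ≤
      (∑ s, ∑ r, ∑ q, |partialDeriv q (partialDeriv r (partialDeriv s ψ)) 0|) * (1 + t ^ 4) := by
    simp only [Finset.sum_mul]
    refine (Finset.abs_sum_le_sum_abs _ _).trans (Finset.sum_le_sum fun s _ => ?_)
    refine (Finset.abs_sum_le_sum_abs _ _).trans (Finset.sum_le_sum fun r _ => ?_)
    refine (Finset.abs_sum_le_sum_abs _ _).trans (Finset.sum_le_sum fun q _ => ?_)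
    rw [abs_mul, abs_mul, abs_mul, mul_comm]
    gcongr
    exact (mul_le_mul (mul_le_mul (hu s) (hu r) (abs_nonneg _) t0) (hu q) (abs_nonneg _)
      (by positivity)).trans b3
  unfold taylorThree
  have c0 : |ψ 0| ≤ |ψ 0| * (1 + t ^ 4) :=
    le_mul_of_one_le_right (abs_nonneg _) (by linarith [pow_nonneg t0 4])
  rw [abs_le] at *
  constructor <;> linarith [c1.1, c1.2, c2.1, c2.2, c3.1, c3.2, c0, neg_abs_le (ψ 0), le_abs_self (ψ 0)]

/-- Expansion at the origin bounds `ψ` by a multiple of `1 + ‖u‖ ^ 4`. The laws may differ between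
coordinates because the hybrid measures of the replacement argument are covered too. -/
lemma integrable_comp_mulVec {n k : ℕ} {ψ : (Fin k → ℝ) → ℝ} (hs : ContDiff ℝ ∞ ψ)
    (hψ : fourthDerivNorm ψ < ⊤) (ν : Fin n → Measure ℝ) [∀ i, IsProbabilityMeasure (ν i)]
    (hν : ∀ i, MemLp (fun x : ℝ => x) 4 (ν i)) (V : Matrix (Fin n) (Fin k) ℝ) :
    Integrable (fun x : Fin n → ℝ => ψ (Vᵀ *ᵥ x)) (Measure.pi ν) := by
  obtain ⟨A, hA, hT⟩ := abs_taylorThree_zero_le ψ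
  have hint : Integrable (fun x : Fin n → ℝ => ‖Vᵀ *ᵥ x‖ ^ 4) (Measure.pi ν) :=
    (memLp_mulVec ν hν V).integrable_norm_pow (p := 4) (by norm_num)
  have hcont : Continuous fun x : Fin n → ℝ => ψ (Vᵀ *ᵥ x) :=
    hs.continuous.comp (continuous_const.matrix_mulVec continuous_id)
  refine ((((integrable_const (1 : ℝ)).add hint).const_mul A).add
    (hint.const_mul (fourthDerivNorm ψ).toReal)).mono' hcont.aestronglyMeasurable
    (Filter.Eventually.of_forall fun x => ?_)
  have h := abs_sub_taylorThree_le hs hψ 0 (Vᵀ *ᵥ x)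
  have h2 := hT (Vᵀ *ᵥ x)
  rw [zero_add] at h
  have h3 := abs_sub_abs_le_abs_sub (ψ (Vᵀ *ᵥ x)) (taylorThree ψ 0 (Vᵀ *ᵥ x))
  simp only [Pi.add_apply, Real.norm_eq_abs]
  linarith

/-! ### Lindeberg replacement -/

lemma abs_integral_sub_integral_le_of_sameMean {Ω : Type*} [MeasurableSpace Ω] {P Q : Measure Ω}
    {F G R : Ω → ℝ} (hG : SameMean P Q G) (hFP : Integrable F P) (hFQ : Integrable F Q)
    (hRP : Integrable R P) (hRQ : Integrable R Q) (h : ∀ x, |F x - G x| ≤ R x) :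
    |∫ x, F x ∂P - ∫ x, F x ∂Q| ≤ ∫ x, R x ∂P + ∫ x, R x ∂Q := by
  have h1 : |∫ x, F x ∂P - ∫ x, G x ∂P| ≤ ∫ x, R x ∂P := by
    rw [← integral_sub hFP hG.1]
    exact (abs_integral_le_integral_abs).trans (integral_mono (hFP.sub hG.1).abs hRP h)
  have h2 : |∫ x, F x ∂Q - ∫ x, G x ∂Q| ≤ ∫ x, R x ∂Q := by
    rw [← integral_sub hFQ hG.2.1]
    exact (abs_integral_le_integral_abs).trans (integral_mono (hFQ.sub hG.2.1).abs hRQ h)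
  rw [hG.2.2] at h1
  rw [abs_le] at *
  constructor <;> linarith [h1.1, h1.2, h2.1, h2.2]

/-- The bound does not depend on `v`, so the coordinates left unchanged can afterwards be integrated
out. -/
lemma abs_integral_translate_sub_le {μ ν : Measure ℝ} (hμ : IsProper μ) (hν : IsProper ν)
    (hμ4 : MemLp (fun x : ℝ => x) 4 μ) (hν4 : MemLp (fun x : ℝ => x) 4 ν) {n k : ℕ}
    {ψ : (Fin k → ℝ) → ℝ} (hs : ContDiff ℝ ∞ ψ) (hψ : fourthDerivNorm ψ < ⊤)
    (V : Matrix (Fin n) (Fin k) ℝ) (v : Fin k → ℝ) :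
    |(∫ x : Fin n → ℝ, ψ (v + Vᵀ *ᵥ x) ∂(Measure.pi fun _ => μ)) -
        ∫ x : Fin n → ℝ, ψ (v + Vᵀ *ᵥ x) ∂(Measure.pi fun _ => ν)| ≤
      (fourthDerivNorm ψ).toReal * ((∫ x : Fin n → ℝ, ‖Vᵀ *ᵥ x‖ ^ 4 ∂(Measure.pi fun _ => μ)) +
        ∫ x : Fin n → ℝ, ‖Vᵀ *ᵥ x‖ ^ 4 ∂(Measure.pi fun _ => ν)) := by
  have := hμ.isProbabilityMeasure
  have := hν.isProbabilityMeasure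
  have hT := sameMean_taylorThree hμ hν ψ V v
  have hRμ : Integrable (fun x : Fin n → ℝ => (fourthDerivNorm ψ).toReal * ‖Vᵀ *ᵥ x‖ ^ 4)
      (Measure.pi fun _ => μ) :=
    ((memLp_mulVec _ (fun _ => hμ4) V).integrable_norm_pow (p := 4) (by norm_num)).const_mul _
  have hRν : Integrable (fun x : Fin n → ℝ => (fourthDerivNorm ψ).toReal * ‖Vᵀ *ᵥ x‖ ^ 4)
      (Measure.pi fun _ => ν) :=
    ((memLp_mulVec _ (fun _ => hν4) V).integrable_norm_pow (p := 4) (by norm_num)).const_mul _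
  have hcont : Continuous fun x : Fin n → ℝ => ψ (v + Vᵀ *ᵥ x) :=
    hs.continuous.comp (continuous_const.add (continuous_const.matrix_mulVec continuous_id))
  have hbound := fun x : Fin n → ℝ => abs_sub_taylorThree_le hs hψ v (Vᵀ *ᵥ x)
  have hF : ∀ P : Measure (Fin n → ℝ), Integrable (fun x => taylorThree ψ v (Vᵀ *ᵥ x)) P →
      Integrable (fun x => (fourthDerivNorm ψ).toReal * ‖Vᵀ *ᵥ x‖ ^ 4) P →
      Integrable (fun x => ψ (v + Vᵀ *ᵥ x)) P := by
    intro P h1 h2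
    refine (h1.abs.add h2).mono' hcont.aestronglyMeasurable
      (Filter.Eventually.of_forall fun x => ?_)
    have h3 := abs_sub_abs_le_abs_sub (ψ (v + Vᵀ *ᵥ x)) (taylorThree ψ v (Vᵀ *ᵥ x))
    simp only [Pi.add_apply, Real.norm_eq_abs]
    linarith [hbound x]
  have := abs_integral_sub_integral_le_of_sameMean hT (hF _ hT.1 hRμ) (hF _ hT.2.1 hRν) hRμ hRν
    hbound
  rwa [integral_const_mul, integral_const_mul, ← mul_add] at this

/-- Drawing the coordinates in `s` from one product measure and the others from another one gives
the mixed product measure. -/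
lemma measurePreserving_piecewise {n : ℕ} (s : Fin n → Prop) [DecidablePred s]
    (ν ν' : Fin n → Measure ℝ) [∀ i, IsProbabilityMeasure (ν i)]
    [∀ i, IsProbabilityMeasure (ν' i)] :
    MeasurePreserving (fun z : (Fin n → ℝ) × (Fin n → ℝ) => fun i => if s i then z.1 i else z.2 i)
      ((Measure.pi ν).prod (Measure.pi ν')) (Measure.pi fun i => if s i then ν i else ν' i) := by
  have : ∀ i, IsProbabilityMeasure (if s i then ν i else ν' i) := fun i => by
    split_ifs <;> infer_instance
  have hmeas : Measurable
      (fun z : (Fin n → ℝ) × (Fin n → ℝ) => fun i => if s i then z.1 i else z.2 i) := by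
    refine measurable_pi_lambda _ fun i => ?_
    split_ifs <;> fun_prop
  refine ⟨hmeas, (Measure.pi_eq fun t ht => ?_).symm⟩
  rw [Measure.map_apply hmeas (MeasurableSet.univ_pi ht)]
  have hpre : (fun z : (Fin n → ℝ) × (Fin n → ℝ) => fun i => if s i then z.1 i else z.2 i) ⁻¹'
      (Set.univ.pi t) = (Set.univ.pi fun i => if s i then t i else Set.univ) ×ˢ
        (Set.univ.pi fun i => if s i then Set.univ else t i) := by
    ext z
    simp only [Set.mem_preimage, Set.mem_pi, Set.mem_univ, true_imp_iff, Set.mem_prod,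
      ← forall_and]
    refine forall_congr' fun i => ?_
    split_ifs <;> simp
  rw [hpre, Measure.prod_prod, Measure.pi_pi, Measure.pi_pi, ← Finset.prod_mul_distrib]
  refine Finset.prod_congr rfl fun i _ => ?_
  split_ifs <;> simp

/-- Replacing the law `μ` of the coordinates in `s` by `ν` changes the mean of `ψ(Wᵀx)` by at most
the fourth moments of the contribution of `s`. -/
lemma abs_integral_replace_sub_le {μ ν : Measure ℝ} (hμ : IsProper μ) (hν : IsProper ν)
    (hμ4 : MemLp (fun x : ℝ => x) 4 μ) (hν4 : MemLp (fun x : ℝ => x) 4 ν) {n k : ℕ}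
    {ψ : (Fin k → ℝ) → ℝ} (hs : ContDiff ℝ ∞ ψ) (hψ : fourthDerivNorm ψ < ⊤)
    (W : Matrix (Fin n) (Fin k) ℝ) (s : Fin n → Prop) [DecidablePred s]
    (κ : Fin n → Measure ℝ) [∀ i, IsProbabilityMeasure (κ i)]
    (hκ : ∀ i, MemLp (fun x : ℝ => x) 4 (κ i)) :
    |(∫ x, ψ (Wᵀ *ᵥ x) ∂(Measure.pi fun i => if s i then μ else κ i)) -
        ∫ x, ψ (Wᵀ *ᵥ x) ∂(Measure.pi fun i => if s i then ν else κ i)| ≤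
      (fourthDerivNorm ψ).toReal *
        ((∫ x : Fin n → ℝ, ‖(Matrix.of fun i p => if s i then W i p else 0)ᵀ *ᵥ x‖ ^ 4
            ∂(Measure.pi fun _ => μ)) +
        ∫ x : Fin n → ℝ, ‖(Matrix.of fun i p => if s i then W i p else 0)ᵀ *ᵥ x‖ ^ 4
            ∂(Measure.pi fun _ => ν)) := by
  have := hμ.isProbabilityMeasure
  have := hν.isProbabilityMeasure
  set V : Matrix (Fin n) (Fin k) ℝ := Matrix.of fun i p => if s i then W i p else 0 with hV
  set U : Matrix (Fin n) (Fin k) ℝ := Matrix.of fun i p => if s i then 0 else W i p with hU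
  set mix := fun z : (Fin n → ℝ) × (Fin n → ℝ) => fun i => if s i then z.1 i else z.2 i with hmix
  have hsplit : ∀ z, Wᵀ *ᵥ mix z = Uᵀ *ᵥ z.2 + Vᵀ *ᵥ z.1 := by
    intro z
    ext p
    simp only [Matrix.mulVec, dotProduct, Matrix.transpose_apply, Pi.add_apply, hV, hU, hmix,
      Matrix.of_apply, ← Finset.sum_add_distrib]
    refine Finset.sum_congr rfl fun i _ => ?_
    split_ifs <;> simp
  have hcont : Continuous fun x : Fin n → ℝ => ψ (Wᵀ *ᵥ x) :=
    hs.continuous.comp (continuous_const.matrix_mulVec continuous_id)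
  have hfub : ∀ (ρ : Measure ℝ) [IsProbabilityMeasure ρ], MemLp (fun x : ℝ => x) 4 ρ →
      Integrable (fun y => ∫ x : Fin n → ℝ, ψ (Uᵀ *ᵥ y + Vᵀ *ᵥ x) ∂(Measure.pi fun _ => ρ))
        (Measure.pi κ) ∧
      ∫ x, ψ (Wᵀ *ᵥ x) ∂(Measure.pi fun i => if s i then ρ else κ i) =
        ∫ y, ∫ x : Fin n → ℝ, ψ (Uᵀ *ᵥ y + Vᵀ *ᵥ x) ∂(Measure.pi fun _ => ρ)
          ∂(Measure.pi κ) := by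
    intro ρ _ hρ
    have hmp := measurePreserving_piecewise s (fun _ => ρ) κ
    have : ∀ i, IsProbabilityMeasure (if s i then ρ else κ i) := fun i => by
      split_ifs <;> infer_instance
    have hi := integrable_comp_mulVec hs hψ (fun i => if s i then ρ else κ i)
      (fun i => by split_ifs; exacts [hρ, hκ i]) W
    have hi2 : Integrable (fun z : (Fin n → ℝ) × (Fin n → ℝ) => ψ (Uᵀ *ᵥ z.2 + Vᵀ *ᵥ z.1))
        ((Measure.pi fun _ => ρ).prod (Measure.pi κ)) := by
      simp only [← hsplit]
      exact hmp.integrable_comp_of_integrable hi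
    refine ⟨hi2.integral_prod_right, ?_⟩
    rw [← integral_prod_symm _ hi2, ← hmp.map_eq, integral_map hmp.aemeasurable
      hcont.aestronglyMeasurable]
    simp only [← hsplit, hmix]
  obtain ⟨hi1, he1⟩ := hfub μ hμ4
  obtain ⟨hi2, he2⟩ := hfub ν hν4
  rw [he1, he2, ← integral_sub hi1 hi2]
  refine abs_integral_le_integral_abs.trans ?_
  refine (integral_mono (hi1.sub hi2).abs (integrable_const _) fun y =>
    abs_integral_translate_sub_le hμ hν hμ4 hν4 hs hψ V (Uᵀ *ᵥ y)).trans ?_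
  simp

/-- Lindeberg's replacement argument along the colour classes of `h`. -/
lemma abs_integral_sub_le_sum_colours {μ ν : Measure ℝ} (hμ : IsProper μ) (hν : IsProper ν)
    (hμ4 : MemLp (fun x : ℝ => x) 4 μ) (hν4 : MemLp (fun x : ℝ => x) 4 ν) {n k : ℕ}
    {ψ : (Fin k → ℝ) → ℝ} (hs : ContDiff ℝ ∞ ψ) (hψ : fourthDerivNorm ψ < ⊤)
    (W : Matrix (Fin n) (Fin k) ℝ) {T : ℕ} (h : Fin n → Fin T) :
    |(∫ x, ψ (Wᵀ *ᵥ x) ∂(Measure.pi fun _ => μ)) -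
        ∫ x, ψ (Wᵀ *ᵥ x) ∂(Measure.pi fun _ => ν)| ≤
      ∑ j, (fourthDerivNorm ψ).toReal *
        ((∫ x : Fin n → ℝ, ‖(Matrix.of fun i p => if h i = j then W i p else 0)ᵀ *ᵥ x‖ ^ 4
            ∂(Measure.pi fun _ => μ)) +
        ∫ x : Fin n → ℝ, ‖(Matrix.of fun i p => if h i = j then W i p else 0)ᵀ *ᵥ x‖ ^ 4
            ∂(Measure.pi fun _ => ν)) := by
  have := hμ.isProbabilityMeasure
  have := hν.isProbabilityMeasure
  -- Hybrid laws: colours below `t` already carry `ν`. Passing from `m j` to `m (j + 1)` changes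
  -- exactly the class `j`.
  set m : ℕ → Fin n → Measure ℝ := fun t i => if (h i : ℕ) < t then ν else μ with hm
  have hmp : ∀ t i, IsProbabilityMeasure (m t i) := fun t i => by
    simp only [hm]; split_ifs <;> infer_instance
  have hm4 : ∀ t i, MemLp (fun x : ℝ => x) 4 (m t i) := fun t i => by
    simp only [hm]; split_ifs; exacts [hν4, hμ4]
  have hm0 : m 0 = fun _ => μ := by ext1 i; simp [hm]
  have hmT : m T = fun _ => ν := by ext1 i; simp [hm]
  have htel := dist_le_range_sum_dist (fun t => ∫ x, ψ (Wᵀ *ᵥ x) ∂(Measure.pi (m t))) T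
  simp only [hm0, hmT, Real.dist_eq, Finset.sum_range] at htel
  refine htel.trans (Finset.sum_le_sum fun j _ => ?_)
  have e1 : m j = fun i => if h i = j then μ else m j i := by
    ext1 i
    by_cases hij : h i = j <;> simp [hm, hij]
  have e2 : m (j + 1) = fun i => if h i = j then ν else m j i := by
    ext1 i
    by_cases hij : h i = j
    · simp [hm, hij]
    · have hne : (h i : ℕ) ≠ j := fun hc => hij (Fin.ext hc)
      have : ((h i : ℕ) < j + 1) = ((h i : ℕ) < j) := by
        rw [eq_iff_iff]; omega
      simp [hm, hij, this]
  have key := abs_integral_replace_sub_le hμ hν hμ4 hν4 hs hψ W (fun i => h i = j) (m j) (hm4 j)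
  rwa [← e1, ← e2] at key

/-! ### Assembling the bound -/

/-- The invariance principle with an explicit constant, without the factor `log (1 / ε)`. -/
lemma abs_integral_sub_le_of_isRegularMatrix {μ ν : Measure ℝ} (hμ : IsProper μ) (hν : IsProper ν)
    {c d : ℝ} (hc : 0 ≤ c) (hd : 0 ≤ d) (hμc : HasSubgaussianForms c μ)
    (hνd : HasSubgaussianForms d ν) {n k : ℕ} (hk : 2 ≤ k)
    {ψ : (Fin k → ℝ) → ℝ} (hs : ContDiff ℝ ∞ ψ) (hψ : fourthDerivNorm ψ < ⊤)
    (W : Matrix (Fin n) (Fin k) ℝ) (hW : ∀ p, ‖WithLp.toLp 2 (W.col p)‖ = 1) {ε : ℝ} (hε : 0 < ε)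
    (hreg : IsRegularMatrix ε W) :
    |(∫ x, ψ (Wᵀ *ᵥ x) ∂(Measure.pi fun _ => μ)) -
        ∫ x, ψ (Wᵀ *ᵥ x) ∂(Measure.pi fun _ => ν)| ≤
      14400 * Real.exp 4 * (c ^ 4 + d ^ 4) * (fourthDerivNorm ψ).toReal * Real.log k ^ 3 * ε := by
  have := hμ.isProbabilityMeasure
  have := hν.isProbabilityMeasure
  have hsum : ∀ p, ∑ i, W i p ^ 2 = 1 := by
    intro p
    have := EuclideanSpace.norm_sq_eq (WithLp.toLp 2 (W.col p))
    rw [hW p] at this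
    simpa using this.symm
  -- Regularity enters only here: one fourth power is at most the whole sum, hence at most `ε²`.
  have hle : ∀ i p, W i p ^ 2 ≤ ε := by
    intro i p
    have h := hreg p
    rw [IsRegularVec, hW p] at h
    have h2 : W i p ^ 4 ≤ ∑ i, W.col p i ^ 4 :=
      Finset.single_le_sum (f := fun i => W i p ^ 4) (fun i _ => by positivity) (Finset.mem_univ i)
    refine le_of_sq_le_sq ?_ hε.le
    nlinarith
  obtain ⟨T, h, M, hM0, hM, hMsum⟩ := exists_balanced_colouring hk hε (fun i p => W i p ^ 2)
    (fun i p => sq_nonneg _) hle hsum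
  refine (abs_integral_sub_le_sum_colours hμ hν hμc.memLp_id hνd.memLp_id hs hψ W h).trans ?_
  have hl := half_le_log_natCast hk
  set B := (fourthDerivNorm ψ).toReal with hB
  have hB0 : 0 ≤ B := ENNReal.toReal_nonneg
  have hV : ∀ j p, ∑ i, (Matrix.of fun i p => if h i = j then W i p else 0) i p ^ 2 ≤ M j := by
    intro j p
    refine le_of_eq_of_le (Finset.sum_congr rfl fun i _ => ?_) (hM j p)
    simp only [Matrix.of_apply]
    split_ifs <;> simp
  calc _ ≤ ∑ j, B * ((144 * Real.exp 4 * c ^ 4) * Real.log k ^ 2 * M j ^ 2 +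
        (144 * Real.exp 4 * d ^ 4) * Real.log k ^ 2 * M j ^ 2) := by
        refine Finset.sum_le_sum fun j _ => ?_
        gcongr
        · exact hμc.integral_norm_mulVec_le hc hk _ (hM0 j) (hV j)
        · exact hνd.integral_norm_mulVec_le hd hk _ (hM0 j) (hV j)
    _ = 144 * Real.exp 4 * (c ^ 4 + d ^ 4) * B * Real.log k ^ 2 * ∑ j, M j ^ 2 := by
        rw [Finset.mul_sum]
        exact Finset.sum_congr rfl fun j _ => by ring
    _ ≤ 144 * Real.exp 4 * (c ^ 4 + d ^ 4) * B * Real.log k ^ 2 *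
        (100 * (ε * Real.log k)) := by gcongr
    _ = _ := by ring

theorem theorem3p2 (μ : Measure ℝ) (hμ : IsProper μ) (hμ' : IsHypercontractive μ)
    (ε₀ : ℝ) (hε₀ : ε₀ < 1) :
    ∃ C : ℝ, 0 < C ∧
      ∀ (n k : ℕ), 2 ≤ k →
      ∀ (W : Matrix (Fin n) (Fin k) ℝ), (∀ p, ‖WithLp.toLp 2 (W.col p)‖ = 1) →
      ∀ (ε : ℝ), 0 < ε → ε ≤ ε₀ → IsRegularMatrix ε W →
      ∀ (ψ : (Fin k → ℝ) → ℝ), ContDiff ℝ ∞ ψ → fourthDerivNorm ψ < ⊤ →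
        Integrable (fun x : Fin n → ℝ => ψ (Wᵀ *ᵥ x)) (Measure.pi fun _ => μ) ∧
        Integrable (fun y : Fin n → ℝ => ψ (Wᵀ *ᵥ y)) (Measure.pi fun _ => gaussianReal 0 1) ∧
        |(∫ x : Fin n → ℝ, ψ (Wᵀ *ᵥ x) ∂(Measure.pi fun _ => μ)) -
            ∫ y : Fin n → ℝ, ψ (Wᵀ *ᵥ y) ∂(Measure.pi fun _ => gaussianReal 0 1)| ≤
          C * (fourthDerivNorm ψ).toReal * Real.log k ^ 3 * (ε * Real.log (1 / ε)) := by

  obtain ⟨c, hc, hμc⟩ := hμ'.exists_hasSubgaussianForms hμ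
  have := hμ.isProbabilityMeasure
  have hγ := hasSubgaussianForms_gaussianReal
  set K := 14400 * Real.exp 4 * (c ^ 4 + 4 ^ 4) with hK
  have hK0 : 0 < K := by positivity
  rcases le_or_gt ε₀ 0 with h0 | h0
  · exact ⟨1, one_pos, fun n k _ W _ ε hε hε' => absurd (hε.trans_le hε') h0.not_gt⟩
  have hlog : 0 < Real.log (1 / ε₀) := Real.log_pos (by rw [lt_div_iff₀ h0]; linarith)
  -- Dividing by `log (1 / ε₀)` pays for the factor `log (1 / ε)`, which is at least as large.
  refine ⟨K / Real.log (1 / ε₀), by positivity, ?_⟩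
  intro n k hk W hW ε hε hε' hreg ψ hs hψ
  refine ⟨integrable_comp_mulVec hs hψ _ (fun _ => hμc.memLp_id) W,
    integrable_comp_mulVec hs hψ _ (fun _ => hγ.memLp_id) W, ?_⟩
  refine (abs_integral_sub_le_of_isRegularMatrix hμ isProper_gaussianReal hc (by norm_num) hμc hγ
    hk hs hψ W hW hε hreg).trans ?_
  rw [← hK]
  have hl := half_le_log_natCast hk
  have hmono : Real.log (1 / ε₀) ≤ Real.log (1 / ε) :=
    Real.log_le_log (by positivity) (one_div_le_one_div_of_le hε hε')
  have hB0 : 0 ≤ (fourthDerivNorm ψ).toReal := ENNReal.toReal_nonneg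
  have hratio : 1 ≤ Real.log (1 / ε) / Real.log (1 / ε₀) := (one_le_div hlog).2 hmono
  calc K * (fourthDerivNorm ψ).toReal * Real.log k ^ 3 * ε
      ≤ K * (fourthDerivNorm ψ).toReal * Real.log k ^ 3 * ε *
          (Real.log (1 / ε) / Real.log (1 / ε₀)) := le_mul_of_one_le_right (by positivity) hratio
    _ = _ := by ring
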